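/- Online linear optimization. Let $E$ be a real Banach space that is $(2,D)$-smooth, i.e. $D>0$ and $\|u+v\|^2+\|u-v\|^2\le 2\|u\|^2+2D^2\|v\|^2$ for all $u,v\in E$, let $E^*$ be its dual with the dual norm $\|\cdot\|$, and let $n\ge 0$ be an integer. In each round $t=1,\dots,n$ the learner selects a Borel probability distribution $q_t$ on $E^*$ (depending only on $y_1,\dots,y_{t-1}$), Nature reveals $y_t$ in the closed unit ball of $E$, and the learner draws $\hat y_t\sim q_t$ and suffers the loss $\langle \hat y_t,y_t\rangle$. For $f\in E^*$ put \[ B(f)=D\sqrt n\left(8\|f\|\left(1+\sqrt{\log(2\|f\|)+\log\log(2\|f\|)}\right)+12\right), \] where $\log$ is the natural logarithm and the square root is read as $0$ when the expression under it is undefined ($2\|f\|\le 1$) or negative; neither happens if $\|f\|\ge 1$. Then the rate $B$ is achievable: there is a randomized strategy of the learner, with finite expected losses, such that \[ \mathbb E\left[\sum_{t=1}^n\langle\hat y_t,y_t\rangle\right]-\sum_{t=1}^n\langle f,y_t\rangle\le B(f) \] for all $y_1,\dots,y_n$ in the closed unit ball of $E$ and, simultaneously, for all $f\in E^*$. -/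

import Mathlib

open MeasureTheory

noncomputable section

namespace OnlineLearning

/-- A randomized strategy of the learner in the `n`-round protocol with instances `X`, decisions
`𝒟` and outcomes `Y`. In round `t` the learner has seen the instances of the rounds up to and
including the current one and the outcomes of the previous rounds, and selects a probability
distribution on `𝒟`, from which the decision is then drawn. -/
def RandomizedStrategy (X 𝒟 Y : Type*) [MeasurableSpace 𝒟] (n : ℕ) :=
  (t : Fin n) → (Fin (t.val + 1) → X) → (Fin t.val → Y) → ProbabilityMeasure 𝒟

/-- The distribution `q_t` that the strategy `q` selects in round `t` when the instances are
`x` and the outcomes are `y`; it only sees the instances up to round `t` and the outcomes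
before round `t`. -/
def RandomizedStrategy.play {X 𝒟 Y : Type*} [MeasurableSpace 𝒟] {n : ℕ}
    (q : RandomizedStrategy X 𝒟 Y n) (x : Fin n → X) (y : Fin n → Y) (t : Fin n) :
    Measure 𝒟 :=
  (q t (fun s => x (Fin.castLE t.isLt s)) (fun s => y (Fin.castLE t.isLt.le s)) :
    ProbabilityMeasure 𝒟)

/-- The adaptive rate `B` is achievable for the loss `ℓ` against the class `F` in `n` rounds:
some randomized strategy has finite expected losses and satisfies
`𝔼 [∑ ℓ(ŷ_t, y_t)] - ∑ ℓ(f(x_t), y_t) ≤ B(f; x, y)` for all instances `x`, all outcomes `y` and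
all `f ∈ F`, where `ŷ_t` is drawn from the distribution selected in round `t`. -/
def IsAchievable {X 𝒟 Y : Type*} [MeasurableSpace 𝒟] (ℓ : 𝒟 → Y → ℝ) (F : Set (X → 𝒟)) (n : ℕ)
    (B : (X → 𝒟) → (Fin n → X) → (Fin n → Y) → ℝ) : Prop :=
  ∃ q : RandomizedStrategy X 𝒟 Y n, ∀ (x : Fin n → X) (y : Fin n → Y),
    (∀ t, Integrable (fun d => ℓ d (y t)) (q.play x y t)) ∧
    ∀ f ∈ F, ∑ t, ∫ d, ℓ d (y t) ∂(q.play x y t) - ∑ t, ℓ (f (x t)) (y t) ≤ B f x y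

/-- `(2, D)`-smoothness of a normed space (Pinelis). -/
def IsTwoSmooth (E : Type*) [NormedAddCommGroup E] (D : ℝ) : Prop :=
  0 < D ∧ ∀ u v : E, ‖u + v‖ ^ 2 + ‖u - v‖ ^ 2 ≤ 2 * ‖u‖ ^ 2 + 2 * D ^ 2 * ‖v‖ ^ 2

/-- The loss `⟨ŷ, y⟩` of online linear optimization: outcomes are in the closed unit ball of `E`
and decisions are continuous linear functionals on `E`. -/
def linearLoss (E : Type*) [NormedAddCommGroup E] [NormedSpace ℝ E]
    (d : StrongDual ℝ E) (y : Metric.closedBall (0 : E) 1) : ℝ :=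
  d (y : E)

/-- `√(log (2r) + log log (2r))`, read as `0` where the expression under the root is undefined
(`2r ≤ 1`) or negative. For `r ≥ 1` the expression is defined and positive. -/
def logTerm (r : ℝ) : ℝ :=
  if 1 < 2 * r then √(max 0 (Real.log (2 * r) + Real.log (Real.log (2 * r)))) else 0

/-- The norm-adaptive rate at a comparator of norm `r`. -/
def normAdaptiveRate (D : ℝ) (n : ℕ) (r : ℝ) : ℝ :=
  D * √(n : ℝ) * (8 * r * (1 + logTerm r) + 12)

end OnlineLearning

end

namespace OnlineLearning

/-! The learner plays minus the scaled gradient of a potential exponential in the squared norm of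
the outcome sum, so a point mass suffices. Smoothness makes each play pay for the growth of the
potential (`IsTwoSmooth.exists_expPotential_step`). Telescoping bounds the unscaled loss by a
constant minus `exp (x ^ 2 / 8)`, with `x` the norm of the final sum over `D * √n`. The comparator
gains at most `‖f‖ * x` on this scale, and the Fenchel-type bound `mul_le_rate_add_exp` absorbs it
for all `f` at once. -/

/-- The elementary inequality behind sub-Gaussian moment bounds. -/
theorem exp_le_self_add_exp_sq (z : ℝ) : Real.exp z ≤ z + Real.exp (z ^ 2) := by
  have hsq := Real.add_one_le_exp (z ^ 2)
  rcases le_or_gt |z| 1 with h | h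
  · have h1 := (abs_le.1 (Real.abs_exp_sub_one_sub_id_le h)).2
    linarith
  · rcases lt_abs.1 h with h | h
    · have : Real.exp z ≤ Real.exp (z ^ 2) := Real.exp_le_exp.2 (by nlinarith)
      linarith
    · have : Real.exp z ≤ 1 := Real.exp_le_one_iff.2 (by linarith)
      nlinarith

section Smooth

variable {E : Type*} [NormedAddCommGroup E] {D : ℝ}

theorem IsTwoSmooth.norm_le_mul (hE : IsTwoSmooth E D) (v : E) : ‖v‖ ≤ D * ‖v‖ := by
  have h := hE.2 0 v
  simp only [zero_add, zero_sub, norm_neg, norm_zero] at h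
  exact abs_le_of_sq_le_sq' (by nlinarith) (mul_nonneg hE.1.le (norm_nonneg v)) |>.2

variable [NormedSpace ℝ E]

/-- A subgradient of half the squared norm gives a quadratic upper bound in a `2`-smooth space. -/
theorem IsTwoSmooth.exists_norm_add_sq_le (hE : IsTwoSmooth E D) (u : E) :
    ∃ g : StrongDual ℝ E, ‖g‖ ≤ ‖u‖ ∧
      ∀ v : E, ‖u + v‖ ^ 2 ≤ ‖u‖ ^ 2 + 2 * g v + 2 * D ^ 2 * ‖v‖ ^ 2 := by
  obtain ⟨g, hg, hgu⟩ := exists_dual_vector'' ℝ u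
  simp only [RCLike.ofReal_real_eq_id, id_eq] at hgu
  refine ⟨‖u‖ • g, ?_, fun v => ?_⟩
  · rw [norm_smul, norm_norm]
    exact mul_le_of_le_one_right (norm_nonneg u) hg
  · have h1 : g (u - v) ≤ ‖u - v‖ :=
      (le_abs_self _).trans ((g.le_opNorm _).trans (mul_le_of_le_one_left (norm_nonneg _) hg))
    rw [map_sub, hgu] at h1
    have h2 := hE.2 u v
    have h3 := mul_le_mul_of_nonneg_left h1 (norm_nonneg u)
    simp only [smul_apply, smul_eq_mul]
    -- The square gives `‖u - v‖ ^ 2 ≥ ‖u‖ ^ 2 - 2 * ‖u‖ * g v`; smoothness turns this into an upper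
    -- bound on `‖u + v‖ ^ 2`.
    nlinarith [sq_nonneg (‖u‖ - ‖u - v‖)]

/-- The exponential potential after `k` of `n` rounds at the partial sum `u` of the outcomes. -/
noncomputable def expPotential (D : ℝ) (n k : ℕ) (u : E) : ℝ :=
  Real.exp (((n : ℝ) - k) / (2 * n) + ‖u‖ ^ 2 / (4 * D ^ 2 * (n + k)))

/-- Two error terms arise: the curvature of the squared norm, paid for by the drop `1 / (2 * n)` of
the time term, and `z ^ 2` from `exp z ≤ z + exp (z ^ 2)`, paid for by the denominator growing from
`n + k` to `n + k + 1`. -/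
theorem IsTwoSmooth.exists_expPotential_step (hE : IsTwoSmooth E D) {n : ℕ} (hn : 0 < n)
    (k : ℕ) (u : E) :
    ∃ w : StrongDual ℝ E, ∀ v : E, ‖v‖ ≤ 1 →
      w v + expPotential D n (k + 1) (u + v) ≤ expPotential D n k u := by
  obtain ⟨g, hg, hgv⟩ := hE.exists_norm_add_sq_le u
  have hD := hE.1
  have hn' : (0 : ℝ) < n := by exact_mod_cast hn
  have hk : (0 : ℝ) ≤ k := k.cast_nonneg
  set m : ℝ := n + k with hm
  have hm0 : 0 < m := by positivity
  set lam : ℝ := 1 / (4 * D ^ 2 * (m + 1)) with hlam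
  have hlam0 : 0 < lam := by positivity
  set A : ℝ := ((n : ℝ) - k) / (2 * n) + lam * ‖u‖ ^ 2 with hA
  -- Chosen so that `w v = -exp A * z`, cancelling the linear term of `exp (A + z)`.
  refine ⟨-(Real.exp A * (2 * lam)) • g, fun v hv => ?_⟩
  set z : ℝ := 2 * lam * g v with hz
  have hstep : expPotential D n (k + 1) (u + v) ≤ Real.exp (A + z) := by
    refine Real.exp_le_exp.2 ?_
    have e : ‖u + v‖ ^ 2 / (4 * D ^ 2 * ((n : ℝ) + (k + 1 : ℕ))) = lam * ‖u + v‖ ^ 2 := by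
      rw [hlam, hm]; push_cast; ring
    have h1 : lam * ‖u + v‖ ^ 2 ≤ lam * (‖u‖ ^ 2 + 2 * g v + 2 * D ^ 2) := by
      refine mul_le_mul_of_nonneg_left ((hgv v).trans ?_) hlam0.le
      have : ‖v‖ ^ 2 ≤ 1 := pow_le_one₀ (norm_nonneg v) hv
      nlinarith [sq_nonneg D]
    have h2 : lam * (2 * D ^ 2) ≤ 1 / (2 * n) := by
      have : lam * (2 * D ^ 2) = 1 / (2 * (m + 1)) := by
        rw [hlam]; field_simp; ring
      rw [this]
      exact one_div_le_one_div_of_le (by positivity) (by linarith)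
    have h3 : ((n : ℝ) - (k + 1 : ℕ)) / (2 * n) = ((n : ℝ) - k) / (2 * n) - 1 / (2 * n) := by
      push_cast; ring
    rw [e, h3]
    linarith
  have hzsq : z ^ 2 ≤ 4 * lam ^ 2 * (D ^ 2 * ‖u‖ ^ 2) := by
    have h1 : |g v| ≤ D * ‖u‖ := by
      calc |g v| ≤ ‖g‖ * ‖v‖ := g.le_opNorm v
        _ ≤ ‖u‖ * 1 := mul_le_mul hg hv (norm_nonneg v) (norm_nonneg u)
        _ ≤ D * ‖u‖ := by simpa using hE.norm_le_mul u
    have h2 : (g v) ^ 2 ≤ (D * ‖u‖) ^ 2 := sq_le_sq' (abs_le.1 h1).1 (abs_le.1 h1).2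
    calc z ^ 2 = 4 * lam ^ 2 * (g v) ^ 2 := by rw [hz]; ring
      _ ≤ 4 * lam ^ 2 * (D * ‖u‖) ^ 2 := by gcongr
      _ = _ := by ring
  -- Reduces to `m * (m + 2) ≤ (m + 1) ^ 2`.
  have hrate : lam + 4 * lam ^ 2 * D ^ 2 ≤ 1 / (4 * D ^ 2 * m) := by
    have e : lam + 4 * lam ^ 2 * D ^ 2 = (m + 2) / (4 * D ^ 2 * (m + 1) ^ 2) := by
      rw [hlam]; field_simp; ring
    rw [e, div_le_div_iff₀ (by positivity) (by positivity)]
    nlinarith [sq_nonneg D]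
  have hfin : Real.exp (A + z ^ 2) ≤ expPotential D n k u := by
    refine Real.exp_le_exp.2 ?_
    have h1 := mul_le_mul_of_nonneg_right hrate (sq_nonneg ‖u‖)
    have e : ‖u‖ ^ 2 / (4 * D ^ 2 * m) = 1 / (4 * D ^ 2 * m) * ‖u‖ ^ 2 := by ring
    rw [e]
    linarith
  have hexp := mul_le_mul_of_nonneg_left (exp_le_self_add_exp_sq z) (Real.exp_pos A).le
  rw [Real.exp_add] at hstep hfin
  have hw : (-(Real.exp A * (2 * lam)) • g) v = -(Real.exp A * z) := by
    simp only [smul_apply, smul_eq_mul, hz]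
    ring
  rw [hw]
  linarith

end Smooth

theorem logTerm_nonneg (r : ℝ) : 0 ≤ logTerm r := by
  unfold logTerm
  split_ifs
  exacts [Real.sqrt_nonneg _, le_rfl]

theorem two_mul_le_exp_logTerm (r : ℝ) :
    2 * r ≤ Real.exp (4 * (1 + logTerm r ^ 2)) := by
  unfold logTerm
  split_ifs with h
  · rw [Real.sq_sqrt (le_max_left _ _)]
    rw [← Real.log_le_iff_le_exp (by linarith)]
    set L := Real.log (2 * r)
    have h0 := le_max_left 0 (L + Real.log L)
    -- `log L` may be negative for small `L`, where the constant 4 suffices; for `L > 4` it can be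
    -- dropped.
    rcases le_or_gt L 4 with hL | hL
    · linarith
    · have := le_max_right 0 (L + Real.log L)
      have := Real.log_nonneg (show (1 : ℝ) ≤ L by linarith)
      linarith
  · exact (not_lt.1 h).trans (Real.one_le_exp (by norm_num))

/-- A Fenchel-type inequality between the exponential potential and the norm-adaptive rate. -/
theorem mul_le_rate_add_exp {r x : ℝ} (hr : 0 ≤ r) (hx : 0 ≤ x) :
    r * x ≤ 8 * r * (1 + logTerm r) + Real.exp (x ^ 2 / 8) := by
  have hl := logTerm_nonneg r
  -- Below the threshold the linear term suffices; above it, `2 * r` and `x / 2` are each at most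
  -- `exp (x ^ 2 / 16)`.
  rcases le_or_gt x (8 * (1 + logTerm r)) with h | h
  · have := mul_le_mul_of_nonneg_left h hr
    have := Real.exp_pos (x ^ 2 / 8)
    linarith
  · have h1 : 2 * r ≤ Real.exp (x ^ 2 / 16) :=
      (two_mul_le_exp_logTerm r).trans (Real.exp_le_exp.2 (by nlinarith))
    have h2 : x / 2 ≤ Real.exp (x ^ 2 / 16) := by
      have := Real.add_one_le_exp (x ^ 2 / 16)
      nlinarith [sq_nonneg (x - 4)]
    have h3 : r * x ≤ Real.exp (x ^ 2 / 8) := by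
      calc r * x = 2 * r * (x / 2) := by ring
        _ ≤ Real.exp (x ^ 2 / 16) * Real.exp (x ^ 2 / 16) :=
          mul_le_mul h1 h2 (by positivity) (Real.exp_pos _).le
        _ = Real.exp (x ^ 2 / 8) := by rw [← Real.exp_add]; ring_nf
    have : 0 ≤ 8 * r * (1 + logTerm r) := by positivity
    linarith

variable {E : Type*} [NormedAddCommGroup E] [NormedSpace ℝ E] {D : ℝ}

/-- Playing the potential-based functionals keeps the regret below the norm-adaptive rate. -/
theorem regret_le_normAdaptiveRate (hD : 0 < D) {n : ℕ} (hn : 0 < n)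
    {w : ℕ → E → StrongDual ℝ E}
    (hw : ∀ k u v, ‖v‖ ≤ 1 → w k u v + expPotential D n (k + 1) (u + v) ≤ expPotential D n k u)
    {y : ℕ → E} (hy : ∀ k, ‖y k‖ ≤ 1) (f : StrongDual ℝ E) :
    D * √(n : ℝ) * ∑ k ∈ Finset.range n, w k (∑ i ∈ Finset.range k, y i) (y k)
      - ∑ k ∈ Finset.range n, f (y k) ≤ normAdaptiveRate D n ‖f‖ := by
  have hn' : (0 : ℝ) < n := by exact_mod_cast hn
  have htel : ∀ m, ∑ k ∈ Finset.range m, w k (∑ i ∈ Finset.range k, y i) (y k)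
      + expPotential D n m (∑ i ∈ Finset.range m, y i) ≤ expPotential D n 0 (0 : E) := by
    intro m
    induction m with
    | zero => simp
    | succ m ih =>
      rw [Finset.sum_range_succ, Finset.sum_range_succ y]
      have := hw m (∑ i ∈ Finset.range m, y i) (y m) (hy m)
      linarith
  set S := ∑ i ∈ Finset.range n, y i with hS
  set c := D * √(n : ℝ) with hc
  have hc0 : 0 < c := mul_pos hD (Real.sqrt_pos.2 hn')
  have hc2 : c ^ 2 = D ^ 2 * n := by rw [hc, mul_pow, Real.sq_sqrt hn'.le]
  have h0 : expPotential D n 0 (0 : E) ≤ 12 := by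
    have e : expPotential D n 0 (0 : E) = Real.exp (1 / 2) := by
      unfold expPotential
      congr 1
      simp
      field_simp
    have h1 : Real.exp (1 / 2) ≤ Real.exp 1 := Real.exp_le_exp.2 (by norm_num)
    have := Real.exp_one_lt_d9
    rw [e]
    linarith
  -- At `k = n` the time term vanishes and the denominator is `8 * c ^ 2`.
  have hend : expPotential D n n S = Real.exp ((‖S‖ / c) ^ 2 / 8) := by
    unfold expPotential
    congr 1
    rw [div_pow, hc2]
    field_simp
    ring
  have hf : -∑ k ∈ Finset.range n, f (y k) ≤ c * (‖f‖ * (‖S‖ / c)) := by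
    rw [← map_sum, ← hS]
    have : c * (‖f‖ * (‖S‖ / c)) = ‖f‖ * ‖S‖ := by field_simp
    rw [this]
    exact (neg_le_abs _).trans (f.le_opNorm S)
  have hfen := mul_le_rate_add_exp (norm_nonneg f) (div_nonneg (norm_nonneg S) hc0.le)
  have hsum := htel n
  rw [← hS, hend] at hsum
  have key := mul_le_mul_of_nonneg_left
    (show ∑ k ∈ Finset.range n, w k (∑ i ∈ Finset.range k, y i) (y k) + ‖f‖ * (‖S‖ / c)
      ≤ 8 * ‖f‖ * (1 + logTerm ‖f‖) + 12 by linarith) hc0.le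
  rw [mul_add] at key
  unfold normAdaptiveRate
  linarith

theorem measurable_linearLoss (y : Metric.closedBall (0 : E) 1) :
    Measurable fun d : StrongDual ℝ E => linearLoss E d y :=
  (ContinuousLinearMap.apply ℝ ℝ (y : E)).continuous.measurable

end OnlineLearning

open OnlineLearning in
theorem mainTheorem9 {E : Type*} [NormedAddCommGroup E] [NormedSpace ℝ E] [CompleteSpace E]
    (D : ℝ) (hE : OnlineLearning.IsTwoSmooth E D) (n : ℕ) :
    OnlineLearning.IsAchievable (X := Unit) (OnlineLearning.linearLoss E) Set.univ n
      (fun f _ _ => OnlineLearning.normAdaptiveRate D n ‖f ()‖) := by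
  -- The potential divides by `n`, so the empty game is separate.
  rcases Nat.eq_zero_or_pos n with rfl | hn
  · exact ⟨fun t => t.elim0, fun x y => ⟨fun t => t.elim0, fun f _ => by simp [normAdaptiveRate]⟩⟩
  choose w hw using fun k (u : E) => hE.exists_expPotential_step hn k u
  set c := D * √(n : ℝ) with hc
  refine ⟨fun t _ y => ⟨Measure.dirac (c • w t (∑ s, (y s : E))), inferInstance⟩,
    fun x y => ⟨fun t => ?_, fun f _ => ?_⟩⟩
  · exact integrable_dirac' (measurable_linearLoss (y t)).stronglyMeasurable (by simp)
  -- Zero padding keeps the outcomes in the unit ball and lets the regret bound run over `ℕ`.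
  · let y' : ℕ → E := fun k => if h : k < n then (y ⟨k, h⟩ : E) else 0
    have hy' : ∀ k, ‖y' k‖ ≤ 1 := by
      intro k
      by_cases h : k < n
      · simpa only [y', h, dite_true] using mem_closedBall_zero_iff.1 (y ⟨k, h⟩).2
      · simp [y', h]
    have hyt : ∀ t : Fin n, y' t = y t := fun t => by simp [y']
    have hplay : ∀ t : Fin n, ∑ s : Fin t.val, (y (Fin.castLE t.isLt.le s) : E)
        = ∑ i ∈ Finset.range t, y' i := fun t => by
      rw [Finset.sum_range]
      exact Finset.sum_congr rfl fun s _ => (hyt (Fin.castLE t.isLt.le s)).symm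
    have key := regret_le_normAdaptiveRate hE.1 hn hw hy' (f ())
    rw [Finset.mul_sum, Finset.sum_range, Finset.sum_range] at key
    convert key using 2
    · refine Finset.sum_congr rfl fun t _ => ?_
      simp only [RandomizedStrategy.play, ProbabilityMeasure.coe_mk]
      rw [integral_dirac' _ _ (measurable_linearLoss (y t)).stronglyMeasurable, hplay, hyt]
      rfl
    · exact Finset.sum_congr rfl fun t _ => by rw [hyt]; rfl
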